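/- For a positive integer $k$ let $\ell^2_+(\mathbb C^k)$ be the Hilbert space of square summable sequences $(x_0,x_1,\dots)$ in $\mathbb C^k$, let $S_k$ be the unilateral shift on it, and let $E_k:\mathbb C^k\to\ell^2_+(\mathbb C^k)$, $E_kx=(x,0,0,\dots)$. For a $k\times r$ matrix function $F(z)=\sum_{n\ge0}z^nF_n$ with entries in $H^\infty(\mathbb D)$, let $T_F:\ell^2_+(\mathbb C^r)\to\ell^2_+(\mathbb C^k)$ be the (bounded) Toeplitz operator $(T_Fu)_n=\sum_{l=0}^{n}F_{n-l}u_l$. Proposition. Let $G$ and $K$ be matrix functions of sizes $m\times p$ and $m\times q$ with entries in $H^\infty(\mathbb D)$ (not necessarily rational), and assume that $T_GT_G^*-T_KT_K^*$ is strictly positive (i.e. positive and boundedly invertible). Then $T_GT_G^*$ is invertible, and $\Lambda=T_G^*(T_GT_G^*)^{-1}T_K$ is a strict contraction, $\|\Lambda\|<1$. For $z\in\mathbb D$ put $$U(z)=E_p^*(I-zS_p^*)^{-1}\Lambda(I-\Lambda^*\Lambda)^{-1}E_q,\qquad V(z)=E_q^*(I-zS_q^*)^{-1}(I-\Lambda^*\Lambda)^{-1}E_q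 .$$ Then $V(z)$ is invertible for every $z\in\mathbb D$. Let $X(z)=U(z)V(z)^{-1}$ (the central commutant lifting solution associated with $\Lambda$), and let $$\Xi=(T_GT_G^*-T_KT_K^*)^{-1}T_KE_q,\qquad D_U=E_p^*T_G^*\,\Xi,\qquad D_V=I_q+E_q^*T_K^*\,\Xi .$$ The matrix $D_V$ is invertible and, with the operator $$F=S_m^*-S_m^*\,\Xi\, D_V^{-1}E_q^*T_K^*\quad\text{on }\ell^2_+(\mathbb C^m),$$ the operator $I-zF$ is invertible for every $z\in\mathbb D$ and $X$ has the infinite-dimensional state space realization $$X(z)=D_UD_V^{-1}+z\left(E_p^*T_G^*-D_UD_V^{-1}E_q^*T_K^*\right)(I-zF)^{-1}S_m^*\,\Xi\, D_V^{-1}\qquad(z\in\mathbb D).$$ Moreover, the spectral radius of $F$ satisfies $r_{\rm spec}(F)\le 1$. -/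

import Mathlib

open scoped InnerProduct

namespace LeechRealization

/-- `ℂ^k` with its Euclidean norm. -/
abbrev CVec (k : ℕ) : Type := EuclideanSpace ℂ (Fin k)

/-- The Hilbert space `ℓ²₊(ℂ^k)` of unilateral square summable sequences in `ℂ^k`. -/
abbrev SeqSpace (k : ℕ) : Type := lp (fun _ : ℕ => CVec k) 2

/-- `F` belongs to `H^∞_{k×r}` as a function on the open unit disc: each entry is bounded and
analytic on the disc (values outside the disc are irrelevant). -/
def MemHInf {k r : ℕ} (F : ℂ → Matrix (Fin k) (Fin r) ℂ) : Prop :=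
  ∀ i j, DifferentiableOn ℂ (fun z => F z i j) (Metric.ball 0 1) ∧
    ∃ C : ℝ, ∀ z ∈ Metric.ball (0 : ℂ) 1, ‖F z i j‖ ≤ C

/-- The `n`-th Taylor coefficient at `0` of a scalar function. -/
noncomputable def taylorCoeff (f : ℂ → ℂ) (n : ℕ) : ℂ := iteratedDeriv n f 0 / (n.factorial : ℂ)

theorem fourierCoeff_circle {f : ℂ → ℂ} (hf : DifferentiableOn ℂ f (Metric.ball 0 1))
    {r : ℝ} (hr0 : 0 < r) (hr1 : r < 1) [Fact (0 < 2 * Real.pi)] (j : ℤ) :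
    fourierCoeff (T := 2 * Real.pi) (fun x => f (r * (AddCircle.toCircle x : ℂ))) j
      = if 0 ≤ j then taylorCoeff f j.toNat * (r : ℂ) ^ j.toNat else 0 := by
  have hsub : Metric.closedBall (0 : ℂ) r ⊆ Metric.ball 0 1 := Metric.closedBall_subset_ball hr1
  have hd : DiffContOnCl ℂ f (Metric.ball 0 r) := (hf.mono hsub).diffContOnCl_ball le_rfl
  have hrc : (r : ℂ) ≠ 0 := by exact_mod_cast hr0.ne'
  have hpi : (Real.pi : ℂ) ≠ 0 := by exact_mod_cast Real.pi_ne_zero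
  rw [fourierCoeff_eq_intervalIntegral _ _ 0]
  have e : ∀ x : ℝ, (AddCircle.toCircle (x : AddCircle (2 * Real.pi)) : ℂ)
      = Complex.exp (x * Complex.I) := by
    intro x
    have := fourier_coe_apply (T := 2 * Real.pi) (n := 1) (x := x)
    rw [fourier_one] at this
    rw [this]; congr 1; push_cast; field_simp
  have e2 : ∀ x : ℝ, (fourier (-j) (x : AddCircle (2 * Real.pi)) : ℂ)
      = Complex.exp (x * Complex.I) ^ (-j) := by
    intro x
    rw [fourier_coe_apply, ← Complex.exp_int_mul]; congr 1; push_cast; field_simp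
  simp only [e, e2, zero_add]
  split_ifs with hj
  · obtain ⟨n, rfl⟩ := Int.eq_ofNat_of_zero_le hj
    have := hd.circleIntegral_one_div_sub_center_pow_smul hr0 n
    rw [circleIntegral] at this
    simp only [deriv_circleMap, circleMap, zero_add, sub_zero, smul_eq_mul] at this
    have h3 : ∀ x : ℝ, (r * Complex.exp (x * Complex.I) * Complex.I) *
        (1 / (r * Complex.exp (x * Complex.I)) ^ (n + 1) * f (r * Complex.exp (x * Complex.I)))
        = (Complex.I / r ^ n) * (Complex.exp (x * Complex.I) ^ (-(n : ℤ)) •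
          f (r * Complex.exp (x * Complex.I))) := by
      intro x
      have := Complex.exp_ne_zero (x * Complex.I)
      rw [zpow_neg, zpow_natCast, smul_eq_mul, mul_pow]
      field_simp
      ring
    simp only [h3] at this
    rw [intervalIntegral.integral_const_mul] at this
    simp only [Int.toNat_natCast, taylorCoeff]
    have hI := Complex.I_ne_zero
    have h4 : ∀ A B : ℂ, Complex.I / r ^ n * A = 2 * Real.pi * Complex.I / n.factorial * B →
        (1 / (2 * Real.pi) : ℝ) • A = B / n.factorial * r ^ n := by
      intro A B h
      have hn : (n.factorial : ℂ) ≠ 0 := by exact_mod_cast n.factorial_ne_zero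
      rw [Complex.real_smul]; push_cast
      field_simp at h ⊢
      linear_combination h
    exact h4 _ _ this
  · obtain ⟨n, hn⟩ : ∃ n : ℕ, -j = n + 1 := ⟨(-j - 1).toNat, by omega⟩
    have hd' : DiffContOnCl ℂ (fun z => z ^ n * f z) (Metric.ball 0 r) := by
      have : DifferentiableOn ℂ (fun z => z ^ n * f z) (Metric.ball 0 1) :=
        (differentiableOn_id.pow n).mul hf
      exact (this.mono hsub).diffContOnCl_ball le_rfl
    have := hd'.circleIntegral_eq_zero hr0.le
    rw [circleIntegral] at this
    simp only [deriv_circleMap, circleMap, zero_add, smul_eq_mul] at this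
    have h3 : ∀ x : ℝ, (r * Complex.exp (x * Complex.I) * Complex.I) *
        ((r * Complex.exp (x * Complex.I)) ^ n * f (r * Complex.exp (x * Complex.I)))
        = (Complex.I * r ^ (n + 1)) * (Complex.exp (x * Complex.I) ^ ((n : ℤ) + 1) •
          f (r * Complex.exp (x * Complex.I))) := by
      intro x
      have h5 : ∀ w : ℂ, w ^ ((n : ℤ) + 1) = w ^ (n + 1) := fun w => by
        rw [← zpow_natCast]; norm_cast
      rw [h5, smul_eq_mul]
      ring
    simp only [h3] at this
    rw [intervalIntegral.integral_const_mul] at this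
    rw [hn]
    rcases mul_eq_zero.mp this with h | h
    · simp [hrc] at h
    · rw [h, smul_zero]

theorem sum_sq_cauchy_aux {f : ℂ → ℂ} (hf : DifferentiableOn ℂ f (Metric.ball 0 1)) {C : ℝ}
    (hC : ∀ z ∈ Metric.ball (0 : ℂ) 1, ‖f z‖ ≤ C) (u : ℕ → ℂ) (N : ℕ) {r : ℝ} (hr0 : 0 < r)
    (hr1 : r < 1) :
    ∑ n ∈ Finset.range N,
        ‖(∑ k ∈ Finset.range (n + 1), taylorCoeff f (n - k) * u k) * (r : ℂ) ^ n‖ ^ 2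
      ≤ C ^ 2 * ∑ k ∈ Finset.range N, ‖u k * (r : ℂ) ^ k‖ ^ 2 := by
  have : Fact (0 < 2 * Real.pi) := ⟨Real.two_pi_pos⟩
  have hmem : ∀ x : AddCircle (2 * Real.pi),
      (r * (AddCircle.toCircle x : ℂ)) ∈ Metric.ball (0 : ℂ) 1 := by
    intro x
    rw [mem_ball_zero_iff, norm_mul, Circle.norm_coe, mul_one, Complex.norm_real,
      Real.norm_of_nonneg hr0.le]
    exact hr1
  let fr : C(AddCircle (2 * Real.pi), ℂ) :=
    ⟨fun x => f (r * (AddCircle.toCircle x : ℂ)), by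
      refine hf.continuousOn.comp_continuous ?_ hmem
      exact continuous_const.mul (continuous_subtype_val.comp AddCircle.continuous_toCircle)⟩
  let pr : C(AddCircle (2 * Real.pi), ℂ) :=
    ∑ k ∈ Finset.range N, (u k * (r : ℂ) ^ k) • fourier (k : ℤ)
  let J := ContinuousMap.toLp (E := ℂ) 2 (AddCircle.haarAddCircle (T := 2 * Real.pi)) ℂ
  have hon := orthonormal_fourier (T := 2 * Real.pi)
  have hp : ‖J pr‖ ^ 2 = ∑ k ∈ Finset.range N, ‖u k * (r : ℂ) ^ k‖ ^ 2 := by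
    have h1 : J pr = ∑ k ∈ Finset.range N, (u k * (r : ℂ) ^ k) •
        fourierLp (T := 2 * Real.pi) 2 (k : ℤ) := by
      simp only [pr, map_sum, map_smul, J]
    have hon' : Orthonormal ℂ (fun k : ℕ => fourierLp (T := 2 * Real.pi) 2 (k : ℤ)) :=
      hon.comp _ Nat.cast_injective
    have h2 := hon'.inner_sum (fun k => u k * (r : ℂ) ^ k) (fun k => u k * (r : ℂ) ^ k)
      (Finset.range N)
    rw [← h1, inner_self_eq_norm_sq_to_K] at h2
    simp only [RCLike.conj_mul] at h2
    exact_mod_cast h2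
  have hc0 : 0 ≤ C := (norm_nonneg _).trans (hC 0 (by simp))
  have hh : ‖J (fr * pr)‖ ≤ C * ‖J pr‖ := by
    apply MeasureTheory.Lp.norm_le_mul_norm_of_ae_le_mul
    filter_upwards [ContinuousMap.coeFn_toLp (𝕜 := ℂ) (p := 2) (AddCircle.haarAddCircle (T := 2 * Real.pi)) (fr * pr),
      ContinuousMap.coeFn_toLp (𝕜 := ℂ) (p := 2) (AddCircle.haarAddCircle (T := 2 * Real.pi)) pr] with x h1 h2
    rw [h1, h2, ContinuousMap.mul_apply, norm_mul]
    exact mul_le_mul_of_nonneg_right (hC _ (hmem x)) (norm_nonneg _)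
  have hB := (hon.comp (fun k : ℕ => (k : ℤ)) Nat.cast_injective).sum_inner_products_le
    (J (fr * pr)) (s := Finset.range N)
  have hcoef : ∀ n ∈ Finset.range N,
      inner ℂ (fourierLp (T := 2 * Real.pi) 2 (n : ℤ)) (J (fr * pr)) =
      (∑ k ∈ Finset.range (n + 1), taylorCoeff f (n - k) * u k) * (r : ℂ) ^ n := by
    intro n hn
    have h1 : fr * pr = ∑ k ∈ Finset.range N, (u k * (r : ℂ) ^ k) • (fr * fourier (k : ℤ)) := by
      simp only [pr, Finset.mul_sum, mul_smul_comm]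
    have h2 : ∀ k : ℕ, inner ℂ (fourierLp (T := 2 * Real.pi) 2 (n : ℤ)) (J (fr * fourier (k : ℤ)))
        = fourierCoeff (fun x => fr x) ((n : ℤ) - k) := by
      intro k
      rw [MeasureTheory.ContinuousMap.inner_toLp, fourierCoeff]
      congr 1; ext x
      rw [ContinuousMap.mul_apply, ← fourier_neg, neg_sub, sub_eq_add_neg, fourier_add, smul_eq_mul]
      ring
    rw [h1, map_sum, inner_sum]
    simp only [map_smul, inner_smul_right, h2]
    have h3 : ∀ k : ℕ, fourierCoeff (fun x => fr x) ((n : ℤ) - k) =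
        if k ≤ n then taylorCoeff f (n - k) * (r : ℂ) ^ (n - k) else 0 := by
      intro k
      have := fourierCoeff_circle hf hr0 hr1 ((n : ℤ) - k)
      refine this.trans ?_
      by_cases hk : k ≤ n
      · have ht : ((n : ℤ) - k).toNat = n - k := by omega
        simp [hk, ht]
      · simp [hk]
    simp only [h3]
    have hN : n < N := Finset.mem_range.mp hn
    rw [Finset.sum_mul]
    symm
    have hss : Finset.range (n + 1) ⊆ Finset.range N := Finset.range_subset_range.mpr hN
    rw [← Finset.sum_subset hss]
    · refine Finset.sum_congr rfl fun k hk => ?_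
      have hk' : k ≤ n := by simpa [Nat.lt_succ_iff] using hk
      rw [if_pos hk']
      have : (r : ℂ) ^ n = (r : ℂ) ^ k * (r : ℂ) ^ (n - k) := by rw [← pow_add]; congr 1; omega
      rw [this]; ring
    · intro k _ hk
      have hk' : ¬ k ≤ n := by simpa [Nat.lt_succ_iff] using hk
      rw [if_neg hk', mul_zero]
  have hB' : ∑ n ∈ Finset.range N,
        ‖(∑ k ∈ Finset.range (n + 1), taylorCoeff f (n - k) * u k) * (r : ℂ) ^ n‖ ^ 2
      ≤ ‖J (fr * pr)‖ ^ 2 := by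
    refine le_trans (le_of_eq (Finset.sum_congr rfl fun n hn => ?_)) hB
    rw [← hcoef n hn]; rfl
  rw [← hp, ← mul_pow]
  exact hB'.trans (pow_le_pow_left₀ (norm_nonneg _) hh 2)

theorem sum_sq_cauchy {f : ℂ → ℂ} (hf : DifferentiableOn ℂ f (Metric.ball 0 1)) {C : ℝ}
    (hC : ∀ z ∈ Metric.ball (0 : ℂ) 1, ‖f z‖ ≤ C) (u : ℕ → ℂ) (N : ℕ) :
    ∑ n ∈ Finset.range N, ‖∑ k ∈ Finset.range (n + 1), taylorCoeff f (n - k) * u k‖ ^ 2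
      ≤ C ^ 2 * ∑ k ∈ Finset.range N, ‖u k‖ ^ 2 := by
  have hl : Filter.Tendsto (fun r : ℝ => ∑ n ∈ Finset.range N,
        ‖(∑ k ∈ Finset.range (n + 1), taylorCoeff f (n - k) * u k) * (r : ℂ) ^ n‖ ^ 2)
      (nhdsWithin 1 (Set.Iio 1)) (nhds (∑ n ∈ Finset.range N,
        ‖∑ k ∈ Finset.range (n + 1), taylorCoeff f (n - k) * u k‖ ^ 2)) := by
    have : Continuous (fun r : ℝ => ∑ n ∈ Finset.range N,
        ‖(∑ k ∈ Finset.range (n + 1), taylorCoeff f (n - k) * u k) * (r : ℂ) ^ n‖ ^ 2) := by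
      fun_prop
    simpa using (this.tendsto 1).mono_left nhdsWithin_le_nhds
  have hr : Filter.Tendsto (fun r : ℝ => C ^ 2 * ∑ k ∈ Finset.range N, ‖u k * (r : ℂ) ^ k‖ ^ 2)
      (nhdsWithin 1 (Set.Iio 1)) (nhds (C ^ 2 * ∑ k ∈ Finset.range N, ‖u k‖ ^ 2)) := by
    have : Continuous (fun r : ℝ => C ^ 2 * ∑ k ∈ Finset.range N, ‖u k * (r : ℂ) ^ k‖ ^ 2) := by
      fun_prop
    simpa using (this.tendsto 1).mono_left nhdsWithin_le_nhds
  refine le_of_tendsto_of_tendsto hl hr ?_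
  filter_upwards [Ioo_mem_nhdsLT (zero_lt_one' ℝ)] with r hr
  exact sum_sq_cauchy_aux hf hC u N hr.1 hr.2

/-- The `n`-th Taylor coefficient `F_n` at `0` of a matrix function, `F(z) = ∑ zⁿ F_n`. -/
noncomputable def taylorMatrix {k r : ℕ} (F : ℂ → Matrix (Fin k) (Fin r) ℂ) (n : ℕ) :
    Matrix (Fin k) (Fin r) ℂ :=
  Matrix.of fun i j => taylorCoeff (fun z => F z i j) n

/-- A linear map into sequences whose partial square sums are bounded defines a bounded operator
between the sequence spaces. -/
noncomputable def seqOperator {k r : ℕ} (T : SeqSpace r →ₗ[ℂ] (ℕ → CVec k))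
    (hT : ∃ B : ℝ, 0 ≤ B ∧ ∀ x N, ∑ n ∈ Finset.range N, ‖T x n‖ ^ 2 ≤ (B * ‖x‖) ^ 2) :
    SeqSpace r →L[ℂ] SeqSpace k :=
  have hfin : ∀ x, ∃ C : ℝ, ∀ s : Finset ℕ, ∑ n ∈ s, ‖T x n‖ ^ (2 : ENNReal).toReal ≤ C := by
    obtain ⟨B, _, hB⟩ := hT
    intro x
    refine ⟨(B * ‖x‖) ^ 2, fun s => ?_⟩
    obtain ⟨N, hN⟩ := s.exists_nat_subset_range
    refine le_trans ?_ (hB x N)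
    simp only [ENNReal.toReal_ofNat, Real.rpow_ofNat]
    exact Finset.sum_le_sum_of_subset_of_nonneg hN fun _ _ _ => by positivity
  LinearMap.mkContinuousOfExistsBound
    { toFun := fun x => ⟨T x, memℓp_gen' (hfin x).choose_spec⟩
      map_add' := fun x y => by ext1; simp; rfl
      map_smul' := fun c x => by ext1; simp }
    (by
      obtain ⟨B, hB0, hB⟩ := hT
      refine ⟨B, fun x => ?_⟩
      refine lp.norm_le_of_forall_sum_le (by simp) (by positivity) fun s => ?_
      obtain ⟨N, hN⟩ := s.exists_nat_subset_range
      simp only [ENNReal.toReal_ofNat, Real.rpow_ofNat]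
      refine le_trans ?_ (hB x N)
      exact Finset.sum_le_sum_of_subset_of_nonneg hN fun _ _ _ => by positivity)

theorem seqOperator_apply {k r : ℕ} (T : SeqSpace r →ₗ[ℂ] (ℕ → CVec k))
    (hT : ∃ B : ℝ, 0 ≤ B ∧ ∀ x N, ∑ n ∈ Finset.range N, ‖T x n‖ ^ 2 ≤ (B * ‖x‖) ^ 2)
    (x : SeqSpace r) (n : ℕ) : seqOperator T hT x n = T x n := rfl

theorem sum_range_norm_sq_le {k : ℕ} (x : SeqSpace k) (N : ℕ) :
    ∑ n ∈ Finset.range N, ‖x n‖ ^ 2 ≤ ‖x‖ ^ 2 := by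
  simpa using lp.sum_rpow_le_norm_rpow (p := 2) (by simp) x (Finset.range N)

/-- The map `(u_n) ↦ (∑_{k ≤ n} F_{n-k} u_k)`, i.e. the action of the block lower triangular
Toeplitz matrix with first column `F_0, F_1, F_2, …`. -/
noncomputable def toeplitzLinear {k r : ℕ} (F : ℂ → Matrix (Fin k) (Fin r) ℂ) :
    SeqSpace r →ₗ[ℂ] (ℕ → CVec k) where
  toFun u n := ∑ l ∈ Finset.range (n + 1), Matrix.toEuclideanLin (taylorMatrix F (n - l)) (u l)
  map_add' u v := by
    funext n
    simp [Finset.sum_add_distrib]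
  map_smul' c u := by
    funext n
    simp [Finset.smul_sum]

theorem toeplitzLinear_bound {k r : ℕ} {F : ℂ → Matrix (Fin k) (Fin r) ℂ} (hF : MemHInf F) :
    ∃ B : ℝ, 0 ≤ B ∧
      ∀ x N, ∑ n ∈ Finset.range N, ‖toeplitzLinear F x n‖ ^ 2 ≤ (B * ‖x‖) ^ 2 := by
  choose hd C hC using hF
  refine ⟨Real.sqrt (∑ i, (r : ℝ) * ∑ j, C i j ^ 2), Real.sqrt_nonneg _, fun x N => ?_⟩
  rw [mul_pow, Real.sq_sqrt (by positivity)]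
  have hcoord : ∀ n i, toeplitzLinear F x n i = ∑ j, ∑ l ∈ Finset.range (n + 1),
      taylorCoeff (fun z => F z i j) (n - l) * x l j := by
    intro n i
    rw [Finset.sum_comm]
    simp [toeplitzLinear, taylorMatrix, Matrix.mulVec, dotProduct]
  have hcs : ∀ n i, ‖toeplitzLinear F x n i‖ ^ 2 ≤ (r : ℝ) * ∑ j,
      ‖∑ l ∈ Finset.range (n + 1), taylorCoeff (fun z => F z i j) (n - l) * x l j‖ ^ 2 := by
    intro n i
    rw [hcoord]
    refine (pow_le_pow_left₀ (norm_nonneg _) (norm_sum_le _ _) 2).trans ?_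
    simpa using sq_sum_le_card_mul_sum_sq (s := (Finset.univ : Finset (Fin r)))
      (f := fun j => ‖∑ l ∈ Finset.range (n + 1),
        taylorCoeff (fun z => F z i j) (n - l) * x l j‖)
  have hx : ∀ j, ∑ l ∈ Finset.range N, ‖x l j‖ ^ 2 ≤ ‖x‖ ^ 2 := by
    intro j
    refine le_trans (Finset.sum_le_sum fun l _ => ?_) (sum_range_norm_sq_le x N)
    exact pow_le_pow_left₀ (norm_nonneg _) (PiLp.norm_apply_le (x l) j) 2
  calc ∑ n ∈ Finset.range N, ‖toeplitzLinear F x n‖ ^ 2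
      = ∑ i, ∑ n ∈ Finset.range N, ‖toeplitzLinear F x n i‖ ^ 2 := by
        rw [Finset.sum_comm]
        exact Finset.sum_congr rfl fun n _ => EuclideanSpace.norm_sq_eq _
    _ ≤ ∑ i, (r : ℝ) * ∑ j, C i j ^ 2 * ‖x‖ ^ 2 := by
        refine Finset.sum_le_sum fun i _ => ?_
        refine (Finset.sum_le_sum fun n _ => hcs n i).trans ?_
        rw [← Finset.mul_sum, Finset.sum_comm]
        refine mul_le_mul_of_nonneg_left (Finset.sum_le_sum fun j _ => ?_) (Nat.cast_nonneg r)
        exact (sum_sq_cauchy (hd i j) (hC i j) (fun l => x l j) N).trans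
          (mul_le_mul_of_nonneg_left (hx j) (sq_nonneg _))
    _ = (∑ i, (r : ℝ) * ∑ j, C i j ^ 2) * ‖x‖ ^ 2 := by
        simp only [← Finset.sum_mul, ← mul_assoc]

/-- The Toeplitz operator `T_F : ℓ²₊(ℂ^r) → ℓ²₊(ℂ^k)` of `F ∈ H^∞_{k×r}`. -/
noncomputable def toeplitz {k r : ℕ} (F : ℂ → Matrix (Fin k) (Fin r) ℂ) (hF : MemHInf F) :
    SeqSpace r →L[ℂ] SeqSpace k :=
  seqOperator (toeplitzLinear F) (toeplitzLinear_bound hF)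

/-- The map `(x₀, x₁, …) ↦ (0, x₀, x₁, …)`. -/
noncomputable def shiftLinear (k : ℕ) : SeqSpace k →ₗ[ℂ] (ℕ → CVec k) where
  toFun x n := match n with
    | 0 => 0
    | l + 1 => x l
  map_add' x y := by
    funext n
    cases n <;> simp
  map_smul' c x := by
    funext n
    cases n <;> simp

theorem shiftLinear_bound (k : ℕ) : ∃ B : ℝ, 0 ≤ B ∧
    ∀ x N, ∑ n ∈ Finset.range N, ‖shiftLinear k x n‖ ^ 2 ≤ (B * ‖x‖) ^ 2 := by
  refine ⟨1, zero_le_one, fun x N => ?_⟩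
  rw [one_mul]
  cases N with
  | zero => simp
  | succ N =>
    rw [Finset.sum_range_succ']
    simpa [shiftLinear] using sum_range_norm_sq_le x N

/-- The unilateral shift `S_k` on `ℓ²₊(ℂ^k)`. -/
noncomputable def shift (k : ℕ) : SeqSpace k →L[ℂ] SeqSpace k :=
  seqOperator (shiftLinear k) (shiftLinear_bound k)

/-- The canonical embedding `E_k` of `ℂ^k` onto the first coordinate space of `ℓ²₊(ℂ^k)`. -/
noncomputable def embed (k : ℕ) : CVec k →L[ℂ] SeqSpace k :=
  lp.singleContinuousLinearMap ℂ (fun _ : ℕ => CVec k) 2 0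

section Central

variable {p q : ℕ} (Λ : SeqSpace q →L[ℂ] SeqSpace p)

/-- `U(z) = E_p^* (I - z S_p^*)⁻¹ Λ (I - Λ^* Λ)⁻¹ E_q`. -/
noncomputable def centralU (z : ℂ) : CVec q →L[ℂ] CVec p :=
  (embed p)† ∘L Ring.inverse (1 - z • (shift p)†) ∘L Λ ∘L Ring.inverse (1 - Λ† ∘L Λ) ∘L embed q

/-- `V(z) = E_q^* (I - z S_q^*)⁻¹ (I - Λ^* Λ)⁻¹ E_q`. -/
noncomputable def centralV (z : ℂ) : CVec q →L[ℂ] CVec q :=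
  (embed q)† ∘L Ring.inverse (1 - z • (shift q)†) ∘L Ring.inverse (1 - Λ† ∘L Λ) ∘L embed q

/-- The central commutant lifting solution `X(z) = U(z) V(z)⁻¹` determined by `Λ`. -/
noncomputable def centralX (z : ℂ) : CVec q →L[ℂ] CVec p :=
  centralU Λ z ∘L Ring.inverse (centralV Λ z)

end Central

section Realization

variable {m p q : ℕ} (TG : SeqSpace p →L[ℂ] SeqSpace m) (TK : SeqSpace q →L[ℂ] SeqSpace m)

/-- `Λ = T_G^* (T_G T_G^*)⁻¹ T_K`. -/
noncomputable def leechLambda : SeqSpace q →L[ℂ] SeqSpace p :=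
  TG† ∘L Ring.inverse (TG ∘L TG†) ∘L TK

/-- `Ξ = (T_G T_G^* - T_K T_K^*)⁻¹ T_K E_q`. -/
noncomputable def Xi : CVec q →L[ℂ] SeqSpace m :=
  Ring.inverse (TG ∘L TG† - TK ∘L TK†) ∘L TK ∘L embed q

/-- `D_U = E_p^* T_G^* Ξ`. -/
noncomputable def DU : CVec q →L[ℂ] CVec p :=
  (embed p)† ∘L TG† ∘L Xi TG TK

/-- `D_V = I_q + E_q^* T_K^* Ξ`. -/
noncomputable def DV : CVec q →L[ℂ] CVec q :=
  1 + (embed q)† ∘L TK† ∘L Xi TG TK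

/-- `F = S_m^* - S_m^* Ξ D_V⁻¹ E_q^* T_K^*`. -/
noncomputable def stateF : SeqSpace m →L[ℂ] SeqSpace m :=
  (shift m)† - (shift m)† ∘L Xi TG TK ∘L Ring.inverse (DV TG TK) ∘L (embed q)† ∘L TK†

end Realization

end LeechRealization

/-! Write A = T_G T_G^* and P = A - T_K T_K^*. Since Λ^*Λ = T_K^* A⁻¹ T_K, the Woodbury formula
gives (I - Λ^*Λ)⁻¹ = I + T_K^* P⁻¹ T_K, hence Λ(I - Λ^*Λ)⁻¹ = T_G^* P⁻¹ T_K. This inverse is at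
least I, which makes Λ a strict contraction. It also turns U and V into point evaluations of T_G^* Ξ
and E_q + T_K^* Ξ. As T_G and T_K intertwine the shifts, the resolvents move to ℓ²₊(ℂ^m): U and V
become D + z b (I - z S_m^*)⁻¹ S_m^* Ξ with the same main operator and input map. Dividing such
realizations is state feedback (`quotient_realization`); it produces F, and V(z) is the Schur
complement that makes I - zF invertible.

The analytic core is invertibility of V(z), by injectivity in finite dimension
(`eq_zero_of_defect_eq_embed`). Put [u, v] = ⟨(I - Λ^*Λ)u, v⟩, h = (I - Λ^*Λ)⁻¹ E x, f = (I -
zS^*)⁻¹ h. If V(z)x = 0, then f = Sg with g = S^* f, and h = f - zg is [·,·]-orthogonal to f. So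
|z|²[g, g] = [f, f] + [h, h], while ‖ΛSg‖ ≤ ‖Λg‖ gives [f, f] ≥ [g, g]. With |z| < 1 this forces g =
0, so h = 0 and x = 0. -/

namespace LeechRealization

/-! ### Inverses applied to vectors; spectral radius. -/

section InverseApply

variable {H : Type*} [NormedAddCommGroup H] [NormedSpace ℂ H]

theorem apply_inverse_apply {T : H →L[ℂ] H} (hT : IsUnit T) (x : H) :
    T (Ring.inverse T x) = x :=
  DFunLike.congr_fun (Ring.mul_inverse_cancel T hT) x

theorem inverse_apply_apply {T : H →L[ℂ] H} (hT : IsUnit T) (x : H) :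
    Ring.inverse T (T x) = x :=
  DFunLike.congr_fun (Ring.inverse_mul_cancel T hT) x

theorem inverse_apply_eq {T : H →L[ℂ] H} (hT : IsUnit T) {x y : H} (h : T y = x) :
    Ring.inverse T x = y := by
  rw [← h, inverse_apply_apply hT]

theorem isUnit_and_inverse_of_apply {T R : H →L[ℂ] H} (hl : ∀ x, R (T x) = x)
    (hr : ∀ x, T (R x) = x) : IsUnit T ∧ Ring.inverse T = R := by
  have hT : IsUnit T :=
    ⟨⟨T, R, ContinuousLinearMap.ext hr, ContinuousLinearMap.ext hl⟩, rfl⟩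
  exact ⟨hT, ContinuousLinearMap.ext fun x => inverse_apply_eq hT (hr x)⟩

/-- The spectral radius is at most one once `1 - z T` is invertible for all `z` in the disc. -/
theorem spectralRadius_le_one_of_isUnit {T : H →L[ℂ] H}
    (h : ∀ z ∈ Metric.ball (0 : ℂ) 1, IsUnit (1 - z • T)) : spectralRadius ℂ T ≤ 1 := by
  refine iSup₂_le fun k hk => ?_
  by_contra! hlt
  have hk1 : 1 < ‖k‖ := by exact_mod_cast hlt
  have hk0 : k ≠ 0 := norm_pos_iff.mp (one_pos.trans hk1)
  have hu := h k⁻¹ (by simpa using inv_lt_one_of_one_lt₀ hk1)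
  refine hk (spectrum.mem_resolventSet_iff.mpr ?_)
  -- For |k| > 1, k - T = k(1 - k⁻¹T) with k⁻¹ in the disc.
  have : algebraMap ℂ (H →L[ℂ] H) k - T = Units.mk0 k hk0 • (1 - k⁻¹ • T) := by
    rw [Units.smul_mk0, smul_sub, smul_inv_smul₀ hk0, Algebra.algebraMap_eq_smul_one]
  rw [this]
  exact hu.smul _

end InverseApply

/-! ### Quotients of transfer functions. -/

section StateSpace

variable {H X Y : Type*} [NormedAddCommGroup H] [NormedSpace ℂ H] [NormedAddCommGroup X]
  [NormedSpace ℂ X] [NormedAddCommGroup Y] [NormedSpace ℂ Y]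

/-- The associated main operator of a realization `D + z b (1 - z A)⁻¹ c` is invertible together
with the value of the transfer function, and the quotient of two transfer functions with common
`A` and `c` has the expected realization. -/
theorem quotient_realization {A : H →L[ℂ] H} {b : H →L[ℂ] X} {c : X →L[ℂ] H} {D V : X →L[ℂ] X}
    {a : H →L[ℂ] Y} {DU U : X →L[ℂ] Y} {z : ℂ} (hA : IsUnit (1 - z • A)) (hD : IsUnit D)
    (hVu : IsUnit V)
    (hV : ∀ x, V x = D x + z • b (Ring.inverse (1 - z • A) (c x)))
    (hU : ∀ x, U x = DU x + z • a (Ring.inverse (1 - z • A) (c x))) :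
    IsUnit (1 - z • (A - c ∘L Ring.inverse D ∘L b)) ∧
      U ∘L Ring.inverse V = DU ∘L Ring.inverse D +
        z • ((a - DU ∘L Ring.inverse D ∘L b) ∘L
          Ring.inverse (1 - z • (A - c ∘L Ring.inverse D ∘L b)) ∘L c ∘L Ring.inverse D) := by
  set R := Ring.inverse (1 - z • A) with hR
  set F := A - c ∘L Ring.inverse D ∘L b with hF
  have e1 : ∀ x, (1 - z • F) x = (1 - z • A) x + z • c (Ring.inverse D (b x)) := by
    intro x
    simp [hF, smul_sub]
    abel
  -- The feedback identity: the correction z c D⁻¹ b R c completes c to c D⁻¹ V. It gives the right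
  -- inverse below and the formula for the quotient.
  have e2 : ∀ x, (1 - z • F) (R (c x)) = c (Ring.inverse D (V x)) := by
    intro x
    rw [e1, apply_inverse_apply hA, hV, map_add, map_add, inverse_apply_apply hD]
    simp
  have hFu : IsUnit (1 - z • F) := by
    -- Woodbury inverse of 1 - zF = (1 - zA) + z c D⁻¹ b, with V in the role of Schur complement.
    refine (isUnit_and_inverse_of_apply (R := R - z • (R ∘L c ∘L Ring.inverse V ∘L b ∘L R))
      (fun x => ?_) fun x => ?_).1
    · have h1 : R ((1 - z • F) x) = x + z • R (c (Ring.inverse D (b x))) := by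
        rw [e1, map_add, inverse_apply_apply hA, map_smul]
      have h2 : Ring.inverse V (b (R ((1 - z • F) x))) = Ring.inverse D (b x) := by
        apply inverse_apply_eq hVu
        rw [hV, apply_inverse_apply hD, h1, map_add, map_smul]
      simp only [sub_apply, smul_apply,
        ContinuousLinearMap.comp_apply] at h1 h2 ⊢
      rw [h2, h1]
      abel
    · simp only [sub_apply (f := R), smul_apply (f := R ∘L _),
        ContinuousLinearMap.comp_apply]
      rw [map_sub, map_smul, e2, apply_inverse_apply hVu, e1, apply_inverse_apply hA]
      abel
  refine ⟨hFu, ContinuousLinearMap.ext fun x => ?_⟩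
  obtain ⟨y, rfl⟩ : ∃ y, V y = x := ⟨_, apply_inverse_apply hVu x⟩
  have e3 : Ring.inverse (1 - z • F) (c (Ring.inverse D (V y))) = R (c y) :=
    inverse_apply_eq hFu (e2 y)
  simp only [add_apply, smul_apply,
    ContinuousLinearMap.comp_apply, sub_apply] at e3 ⊢
  rw [inverse_apply_apply hVu, e3, hU, hV]
  simp only [map_add, map_smul, inverse_apply_apply hD, smul_sub]
  abel

end StateSpace

/-! ### Defect operator of Λ for abstract T_G and T_K. -/

section Hilbert

variable {H₁ H₂ H : Type*} [NormedAddCommGroup H₁] [InnerProductSpace ℂ H₁] [CompleteSpace H₁]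
  [NormedAddCommGroup H₂] [InnerProductSpace ℂ H₂] [CompleteSpace H₂]
  [NormedAddCommGroup H] [InnerProductSpace ℂ H] [CompleteSpace H]

theorem comp_adjoint_nonneg (T : H₁ →L[ℂ] H) : 0 ≤ T ∘L T† := by
  rw [ContinuousLinearMap.nonneg_iff_isPositive]
  exact ContinuousLinearMap.isPositive_self_comp_adjoint T

section Defect

variable {TG : H₁ →L[ℂ] H} {TK : H₂ →L[ℂ] H}

/-- T_G T_G^* dominates the strictly positive operator P. -/
theorem isUnit_comp_adjoint (hpos : IsStrictlyPositive (TG ∘L TG† - TK ∘L TK†)) :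
    IsUnit (TG ∘L TG†) :=
  CStarAlgebra.isUnit_of_le _ (sub_le_self _ (comp_adjoint_nonneg TK)) hpos

theorem adjoint_inverse_comp_adjoint (T : H₁ →L[ℂ] H) :
    (Ring.inverse (T ∘L T†))† = Ring.inverse (T ∘L T†) := by
  have := Ring.inverse_star (T ∘L T†)
  rw [ContinuousLinearMap.star_eq_adjoint, ContinuousLinearMap.star_eq_adjoint,
    ContinuousLinearMap.adjoint_comp, ContinuousLinearMap.adjoint_adjoint] at this
  exact this.symm

theorem adjoint_contraction (TG : H₁ →L[ℂ] H) (TK : H₂ →L[ℂ] H) :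
    (TG† ∘L Ring.inverse (TG ∘L TG†) ∘L TK)† = TK† ∘L Ring.inverse (TG ∘L TG†) ∘L TG := by
  rw [ContinuousLinearMap.adjoint_comp, ContinuousLinearMap.adjoint_comp,
    adjoint_inverse_comp_adjoint, ContinuousLinearMap.adjoint_adjoint]
  rfl

/-- The Woodbury identity `(1 - Λ* Λ)⁻¹ = 1 + T_K* (T_G T_G* - T_K T_K*)⁻¹ T_K`. -/
theorem isUnit_defect_and_inverse (hpos : IsStrictlyPositive (TG ∘L TG† - TK ∘L TK†)) :
    IsUnit (1 - (TG† ∘L Ring.inverse (TG ∘L TG†) ∘L TK)† ∘L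
        (TG† ∘L Ring.inverse (TG ∘L TG†) ∘L TK)) ∧
      Ring.inverse (1 - (TG† ∘L Ring.inverse (TG ∘L TG†) ∘L TK)† ∘L
        (TG† ∘L Ring.inverse (TG ∘L TG†) ∘L TK)) =
      1 + TK† ∘L Ring.inverse (TG ∘L TG† - TK ∘L TK†) ∘L TK := by
  have hA := isUnit_comp_adjoint hpos
  have hP := hpos.isUnit
  rw [adjoint_contraction]
  have hAi : ∀ x, TG ((TG†) (Ring.inverse (TG ∘L TG†) x)) = x := apply_inverse_apply hA
  have hAi' : ∀ x, Ring.inverse (TG ∘L TG†) (TG ((TG†) x)) = x := inverse_apply_apply hA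
  -- P P⁻¹ = 1 and P⁻¹ P = 1 are solved for T_K T_K^*, so that the products below cancel term by
  -- term.
  have hPi : ∀ x, TK ((TK†) (Ring.inverse (TG ∘L TG† - TK ∘L TK†) x)) =
      TG ((TG†) (Ring.inverse (TG ∘L TG† - TK ∘L TK†) x)) - x := fun x =>
    eq_sub_of_add_eq' (sub_eq_iff_eq_add.mp (apply_inverse_apply hP x)).symm
  have hPi' : ∀ x, Ring.inverse (TG ∘L TG† - TK ∘L TK†) (TK ((TK†) x)) =
      Ring.inverse (TG ∘L TG† - TK ∘L TK†) (TG ((TG†) x)) - x := fun x => by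
    have := inverse_apply_apply hP x
    rw [sub_apply, map_sub] at this
    exact eq_sub_of_add_eq' (sub_eq_iff_eq_add.mp this).symm
  refine isUnit_and_inverse_of_apply (fun x => ?_) fun x => ?_
  · simp only [sub_apply, add_apply,
      one_apply_eq_self, ContinuousLinearMap.comp_apply, map_sub, hAi, hPi']
    abel
  · simp only [sub_apply, add_apply,
      one_apply_eq_self, ContinuousLinearMap.comp_apply, map_add, map_sub, hAi, hAi',
      hPi]
    abel

/-- Since T_K(1 + T_K^* P⁻¹ T_K) = (P + T_K T_K^*) P⁻¹ T_K = A P⁻¹ T_K, the factor A⁻¹ in Λ cancels.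
-/
theorem contraction_apply_inverse_defect (hpos : IsStrictlyPositive (TG ∘L TG† - TK ∘L TK†))
    (x : H₂) :
    (TG†) (Ring.inverse (TG ∘L TG†) (TK ((1 + TK† ∘L Ring.inverse (TG ∘L TG† - TK ∘L TK†) ∘L TK)
      x))) = (TG†) (Ring.inverse (TG ∘L TG† - TK ∘L TK†) (TK x)) := by
  have hA := isUnit_comp_adjoint hpos
  have hPi := sub_eq_iff_eq_add.mp (apply_inverse_apply hpos.isUnit (TK x))
  congr 1
  apply inverse_apply_eq hA
  simpa using hPi

/-- An operator whose defect `1 - T* T` has inverse bounded below by one is a strict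
contraction. -/
theorem norm_lt_one_of_defect {T : H₂ →L[ℂ] H₁} {M : H₂ →L[ℂ] H₂}
    (hM : ∀ x, M ((1 - T† ∘L T) x) = x) (hM1 : ∀ x, ‖x‖ ^ 2 ≤ RCLike.re (inner ℂ (M x) x)) :
    ‖T‖ < 1 := by
  have hpos : (0 : ℝ) < 1 + ‖M‖ := by positivity
  -- With y = (1 - T^*T)x one has ‖y‖² ≤ ⟨x, y⟩ = ‖x‖² - ‖Tx‖² and ‖x‖ ≤ ‖M‖‖y‖. Using 1 + ‖M‖ keeps
  -- the inverse meaningful when M = 0 and ensures c ≥ 0.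
  set c := 1 - ((1 + ‖M‖) ^ 2)⁻¹ with hc
  have hc1 : c < 1 := sub_lt_self _ (by positivity)
  have hc0 : 0 ≤ c := sub_nonneg.mpr (inv_le_one_of_one_le₀ (one_le_pow₀ (by simp)))
  have hle : ∀ x, ‖T x‖ ^ 2 ≤ c * ‖x‖ ^ 2 := by
    intro x
    set y := (1 - T† ∘L T) x with hy
    have h1 := hM1 y
    rw [hM] at h1
    have h2 : RCLike.re (inner ℂ x y) = ‖x‖ ^ 2 - ‖T x‖ ^ 2 := by
      rw [hy, sub_apply, inner_sub_right, ContinuousLinearMap.comp_apply,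
        ContinuousLinearMap.adjoint_inner_right, one_apply_eq_self, map_sub,
        inner_self_eq_norm_sq, inner_self_eq_norm_sq]
    have h3 : ‖x‖ ≤ (1 + ‖M‖) * ‖y‖ := by
      have := M.le_opNorm y
      rw [hM] at this
      linarith [norm_nonneg y]
    have h4 : ‖x‖ ^ 2 ≤ (1 + ‖M‖) ^ 2 * ‖y‖ ^ 2 := by
      rw [← mul_pow]
      exact pow_le_pow_left₀ (norm_nonneg _) h3 2
    have h5 : ((1 + ‖M‖) ^ 2)⁻¹ * ‖x‖ ^ 2 ≤ ‖y‖ ^ 2 := by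
      rwa [inv_mul_le_iff₀ (by positivity)]
    rw [hc, sub_mul, one_mul]
    linarith
  refine lt_of_le_of_lt (T.opNorm_le_bound (Real.sqrt_nonneg c) fun x => ?_)
    ((Real.sqrt_lt' one_pos).mpr (by simpa using hc1))
  rw [← abs_of_nonneg (norm_nonneg (T x)), ← Real.sqrt_sq_eq_abs]
  refine (Real.sqrt_le_sqrt (hle x)).trans_eq ?_
  rw [Real.sqrt_mul hc0, Real.sqrt_sq (norm_nonneg x)]

/-- By Woodbury the inverse defect is 1 plus the positive operator T_K^* P⁻¹ T_K. -/
theorem norm_contraction_lt_one (hpos : IsStrictlyPositive (TG ∘L TG† - TK ∘L TK†)) :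
    ‖TG† ∘L Ring.inverse (TG ∘L TG†) ∘L TK‖ < 1 := by
  obtain ⟨hu, hi⟩ := isUnit_defect_and_inverse hpos
  refine norm_lt_one_of_defect (fun x => inverse_apply_apply hu x) fun x => ?_
  rw [hi]
  have h1 : 0 ≤ RCLike.re (inner ℂ (Ring.inverse (TG ∘L TG† - TK ∘L TK†) (TK x)) (TK x)) := by
    have := ((ContinuousLinearMap.nonneg_iff_isPositive _).mp hpos.nonneg).re_inner_nonneg_right
      (Ring.inverse (TG ∘L TG† - TK ∘L TK†) (TK x))
    rwa [apply_inverse_apply hpos.isUnit] at this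
  rw [add_apply, inner_add_left, map_add, one_apply_eq_self,
    inner_self_eq_norm_sq, ContinuousLinearMap.comp_apply, ContinuousLinearMap.adjoint_inner_left]
  exact le_add_of_nonneg_right h1

/-- If shifts are intertwined by `TG` and `TK`, then `Λ` is norm decreasing along the shift. -/
theorem norm_contraction_shift_le (hA : IsUnit (TG ∘L TG†)) {S₁ : H₁ →L[ℂ] H₁}
    {S₂ : H₂ →L[ℂ] H₂} {S : H →L[ℂ] H} (hG : ∀ x, TG (S₁ x) = S (TG x))
    (hK : ∀ x, TK (S₂ x) = S (TK x)) (hS : ∀ x, ‖(S₁†) x‖ ≤ ‖x‖) (u : H₂) :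
    ‖(TG† ∘L Ring.inverse (TG ∘L TG†) ∘L TK) (S₂ u)‖ ≤
      ‖(TG† ∘L Ring.inverse (TG ∘L TG†) ∘L TK) u‖ := by
  simp only [ContinuousLinearMap.comp_apply, hK]
  set Ai := Ring.inverse (TG ∘L TG†)
  set w := TK u
  set v := Ai (S w)
  have hAi : ∀ x, TG ((TG†) (Ai x)) = x := apply_inverse_apply hA
  have hG' : ∀ x, (TG†) ((S†) x) = (S₁†) ((TG†) x) := by
    intro x
    refine ext_inner_left ℂ fun y => ?_
    simp only [ContinuousLinearMap.adjoint_inner_right, hG]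
  -- Here T_G^* v = ΛS₂u is the least-norm solution of T_G x = S T_K u, and S₁Λu is another
  -- solution. Pairing the two replaces a projection argument by Cauchy–Schwarz.
  have h1 : inner ℂ ((TG†) v) ((TG†) v) = inner ℂ ((TG†) (Ai w)) ((S₁†) ((TG†) v)) := by
    rw [ContinuousLinearMap.adjoint_inner_right, hAi, ← hG',
      ContinuousLinearMap.adjoint_inner_right, hAi, ContinuousLinearMap.adjoint_inner_right]
  have h2 : ‖(TG†) v‖ * ‖(TG†) v‖ ≤ ‖(TG†) (Ai w)‖ * ‖(TG†) v‖ := by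
    rw [← @inner_self_eq_norm_mul_norm ℂ, h1]
    exact (re_inner_le_norm _ _).trans (mul_le_mul_of_nonneg_left (hS _) (norm_nonneg _))
  rcases (norm_nonneg ((TG†) v)).eq_or_lt with h0 | h0
  · rw [← h0]
    exact norm_nonneg _
  · exact le_of_mul_le_mul_right h2 h0

end Defect

/-! ### Nonvanishing on the disc. -/

section Wandering

variable {X : Type*} [NormedAddCommGroup X] [InnerProductSpace ℂ X] [CompleteSpace X]

/-- A nonzero element `(1 - Λ* Λ)⁻¹ E x` does not vanish at any point of the disc. -/
theorem eq_zero_of_defect_eq_embed {T : H₂ →L[ℂ] H₁} (hT : ‖T‖ < 1) {S : H₂ →L[ℂ] H₂}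
    {E : X →L[ℂ] H₂} (hSS : ∀ x, (S†) (S x) = x) (hES : ∀ x, (E†) (S x) = 0)
    (hSE : ∀ x, S ((S†) x) + E ((E†) x) = x) (hTS : ∀ x, ‖T (S x)‖ ≤ ‖T x‖) {z : ℂ}
    (hz : ‖z‖ < 1) (hu : IsUnit (1 - z • S†)) {h : H₂} {x : X}
    (hh : (1 - T† ∘L T) h = E x) (h0 : (E†) (Ring.inverse (1 - z • S†) h) = 0) : h = 0 := by
  set f := Ring.inverse (1 - z • S†) h
  set g := (S†) f with hg
  -- The vanishing of E^* f is used here: f lies in the range of S.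
  have hSg : S g = f := by simpa [h0] using hSE f
  have hf : f - z • g = h := by
    have := apply_inverse_apply hu h
    simpa using this
  have hN : ∀ u, RCLike.re (inner ℂ ((1 - T† ∘L T) u) u) = ‖u‖ ^ 2 - ‖T u‖ ^ 2 := by
    intro u
    rw [sub_apply, inner_sub_left, ContinuousLinearMap.comp_apply,
      ContinuousLinearMap.adjoint_inner_left, one_apply_eq_self, map_sub,
      inner_self_eq_norm_sq, inner_self_eq_norm_sq]
  have hNs : ∀ u v, inner ℂ ((1 - T† ∘L T) u) v = inner ℂ u ((1 - T† ∘L T) v) := by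
    intro u v
    simp only [sub_apply, one_apply_eq_self,
      ContinuousLinearMap.comp_apply, inner_sub_left, inner_sub_right,
      ContinuousLinearMap.adjoint_inner_left, ContinuousLinearMap.adjoint_inner_right]
  have hcontr : ∀ u, ‖T u‖ ≤ ‖T‖ * ‖u‖ := T.le_opNorm
  have hdef : ∀ u, 0 ≤ ‖u‖ ^ 2 - ‖T u‖ ^ 2 := fun u => by
    have : ‖T u‖ ≤ ‖u‖ := (hcontr u).trans (mul_le_of_le_one_left (norm_nonneg _) hT.le)
    exact sub_nonneg.mpr (pow_le_pow_left₀ (norm_nonneg _) this 2)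
  -- The defect of h is Ex, which is orthogonal to the range of S.
  have horth : inner ℂ ((1 - T† ∘L T) h) f = 0 := by
    rw [hh, ← ContinuousLinearMap.adjoint_inner_right, ← hSg, hES, inner_zero_right]
  set a := inner ℂ ((1 - T† ∘L T) f) f
  set b := inner ℂ ((1 - T† ∘L T) g) g
  set d := inner ℂ ((1 - T† ∘L T) g) f with hd
  have had : a = (starRingEnd ℂ) z * d := by
    rw [← hf, map_sub, map_smul, inner_sub_left, inner_smul_left] at horth
    exact sub_eq_zero.mp horth
  have hdc : inner ℂ ((1 - T† ∘L T) f) g = (starRingEnd ℂ) d := by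
    rw [hNs, hd, inner_conj_symm]
  -- Pythagoras in the defect form for zg = f - h, up to a conjugate on a that disappears on taking
  -- real parts.
  have hhh : inner ℂ ((1 - T† ∘L T) h) h = - (starRingEnd ℂ) a + z * (starRingEnd ℂ) z * b := by
    have : inner ℂ ((1 - T† ∘L T) h) h = - (z * inner ℂ ((1 - T† ∘L T) h) g) := by
      conv_lhs => rw [← hf, inner_sub_right, hf, horth, inner_smul_right, zero_sub]
    rw [this, ← hf, map_sub, map_smul, inner_sub_left, inner_smul_left, hdc, had]
    simp only [map_mul, Complex.conj_conj]
    ring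
  have hre : ‖h‖ ^ 2 - ‖T h‖ ^ 2 =
      -(‖f‖ ^ 2 - ‖T f‖ ^ 2) + ‖z‖ ^ 2 * (‖g‖ ^ 2 - ‖T g‖ ^ 2) := by
    rw [← hN, ← hN f, ← hN g, hhh, Complex.mul_conj, Complex.normSq_eq_norm_sq]
    simp only [RCLike.re_to_complex, Complex.add_re, Complex.neg_re, Complex.conj_re,
      Complex.re_ofReal_mul]
    rfl
  have hnf : ‖f‖ = ‖g‖ := by
    have : ‖f‖ ^ 2 = ‖g‖ ^ 2 := by
      rw [← @inner_self_eq_norm_sq ℂ, ← @inner_self_eq_norm_sq ℂ]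
      conv_lhs => rw [← hSg, ← ContinuousLinearMap.adjoint_inner_right, hSS]
    exact (pow_left_inj₀ (norm_nonneg _) (norm_nonneg _) two_ne_zero).mp this
  have hTf : ‖T f‖ ^ 2 ≤ ‖T g‖ ^ 2 := by
    rw [← hSg]
    exact pow_le_pow_left₀ (norm_nonneg _) (hTS g) 2
  have hz2 : ‖z‖ ^ 2 < 1 := pow_lt_one₀ (norm_nonneg _) hz two_ne_zero
  -- 0 ≤ [h, h] ≤ (|z|² - 1)[g, g].
  have hDg : ‖g‖ ^ 2 - ‖T g‖ ^ 2 ≤ 0 := by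
    have h1 := hdef h
    rw [hre, hnf] at h1
    nlinarith
  have hg0 : ‖g‖ = 0 := by
    by_contra hne
    have hgpos : 0 < ‖g‖ := (norm_nonneg g).lt_of_ne' hne
    have h2 : ‖T g‖ < ‖g‖ := (hcontr g).trans_lt (mul_lt_of_lt_one_left hgpos hT)
    have h3 := pow_lt_pow_left₀ h2 (norm_nonneg _) two_ne_zero
    linarith
  rw [← hf, norm_eq_zero.mp hg0, norm_eq_zero.mp (hnf.trans hg0), smul_zero, sub_zero]

end Wandering

end Hilbert

/-! ### Shifts, embeddings and Toeplitz operators in coordinates. -/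

section Sequences

theorem shift_apply_zero {k : ℕ} (x : SeqSpace k) : shift k x 0 = 0 := rfl

theorem shift_apply_succ {k : ℕ} (x : SeqSpace k) (n : ℕ) : shift k x (n + 1) = x n := rfl

theorem embed_apply_zero {k : ℕ} (x : CVec k) : embed k x 0 = x := by
  simp [embed]

theorem embed_apply_succ {k : ℕ} (x : CVec k) (n : ℕ) : embed k x (n + 1) = 0 := by
  simp [embed, lp.single_apply]

theorem embed_adjoint_apply {k : ℕ} (x : SeqSpace k) : ((embed k)†) x = x 0 := by
  refine ext_inner_left ℂ fun v => ?_
  rw [ContinuousLinearMap.adjoint_inner_right]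
  exact lp.inner_single_left (𝕜 := ℂ) (G := fun _ : ℕ => CVec k) 0 v x

theorem shift_single {k : ℕ} (n : ℕ) (v : CVec k) :
    shift k (lp.single 2 n v) = lp.single 2 (n + 1) v := by
  ext1
  funext j
  cases j with
  | zero => simp [shift_apply_zero, lp.single_apply]
  | succ j =>
    rw [shift_apply_succ]
    by_cases h : j = n
    · subst h
      simp
    · rw [lp.single_apply_ne _ _ _ h, lp.single_apply_ne _ _ _ (by simpa using h)]

theorem shift_adjoint_apply {k : ℕ} (x : SeqSpace k) (n : ℕ) :
    ((shift k)†) x n = x (n + 1) := by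
  refine ext_inner_left ℂ fun v => ?_
  have h1 := lp.inner_single_left (𝕜 := ℂ) (G := fun _ : ℕ => CVec k) n v (((shift k)†) x)
  have h2 := lp.inner_single_left (𝕜 := ℂ) (G := fun _ : ℕ => CVec k) (n + 1) v x
  rw [ContinuousLinearMap.adjoint_inner_right, shift_single] at h1
  exact h1.symm.trans h2

theorem shift_adjoint_shift {k : ℕ} (x : SeqSpace k) : ((shift k)†) (shift k x) = x := by
  ext1
  funext n
  rw [shift_adjoint_apply, shift_apply_succ]

theorem embed_adjoint_shift {k : ℕ} (x : SeqSpace k) : ((embed k)†) (shift k x) = 0 := by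
  rw [embed_adjoint_apply, shift_apply_zero]

theorem embed_adjoint_embed {k : ℕ} (x : CVec k) : ((embed k)†) (embed k x) = x := by
  rw [embed_adjoint_apply, embed_apply_zero]

theorem shift_adjoint_embed {k : ℕ} (x : CVec k) : ((shift k)†) (embed k x) = 0 := by
  ext1
  funext n
  rw [shift_adjoint_apply, embed_apply_succ]
  rfl

theorem shift_shift_adjoint_add {k : ℕ} (x : SeqSpace k) :
    shift k (((shift k)†) x) + embed k (((embed k)†) x) = x := by
  ext1
  funext n
  rw [lp.coeFn_add, Pi.add_apply]
  cases n with
  | zero => rw [shift_apply_zero, embed_apply_zero, embed_adjoint_apply, zero_add]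
  | succ n => rw [shift_apply_succ, shift_adjoint_apply, embed_apply_succ, add_zero]

theorem norm_shift_adjoint_le_one (k : ℕ) : ‖(shift k)†‖ ≤ 1 := by
  rw [LinearIsometryEquiv.norm_map]
  refine (shift k).opNorm_le_bound zero_le_one fun x => ?_
  rw [one_mul]
  refine le_of_eq ((pow_left_inj₀ (norm_nonneg _) (norm_nonneg _) two_ne_zero).mp ?_)
  rw [← @inner_self_eq_norm_sq ℂ, ← @inner_self_eq_norm_sq ℂ,
    ← ContinuousLinearMap.adjoint_inner_right, shift_adjoint_shift]

theorem norm_shift_adjoint_apply_le {k : ℕ} (x : SeqSpace k) : ‖((shift k)†) x‖ ≤ ‖x‖ := by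
  simpa using ((shift k)†).le_of_opNorm_le (norm_shift_adjoint_le_one k) x

theorem isUnit_one_sub_smul_shift_adjoint (k : ℕ) {z : ℂ} (hz : ‖z‖ < 1) :
    IsUnit (1 - z • (shift k)†) := by
  refine isUnit_one_sub_of_norm_lt_one ?_
  rw [norm_smul]
  exact (mul_le_of_le_one_right (norm_nonneg _) (norm_shift_adjoint_le_one k)).trans_lt hz

/-- The main theorem uses the Toeplitz structure of T_G and T_K only through this intertwining. -/
theorem toeplitz_shift {k r : ℕ} {F : ℂ → Matrix (Fin k) (Fin r) ℂ} (hF : MemHInf F)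
    (x : SeqSpace r) : toeplitz F hF (shift r x) = shift k (toeplitz F hF x) := by
  ext1
  funext n
  cases n with
  | zero => simp [toeplitz, seqOperator_apply, toeplitzLinear, shift_apply_zero]
  | succ n =>
    rw [shift_apply_succ]
    simp only [toeplitz, seqOperator_apply, toeplitzLinear, LinearMap.coe_mk, AddHom.coe_mk]
    -- The split-off l = 0 term vanishes, as a shifted sequence starts with 0; the others are
    -- reindexed by one.
    rw [Finset.sum_range_succ']
    simp [shift_apply_zero, shift_apply_succ]

theorem adjoint_shift_adjoint {k r : ℕ} {T : SeqSpace r →L[ℂ] SeqSpace k}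
    (hT : ∀ x, T (shift r x) = shift k (T x)) (x : SeqSpace k) :
    ((shift r)†) ((T†) x) = (T†) (((shift k)†) x) := by
  refine ext_inner_left ℂ fun y => ?_
  simp only [ContinuousLinearMap.adjoint_inner_right, hT]

/-- Point evaluation at `z` of `T* y`, for `T` intertwining the shifts. -/
theorem embed_adjoint_resolvent_adjoint {k r : ℕ} {T : SeqSpace r →L[ℂ] SeqSpace k}
    (hT : ∀ x, T (shift r x) = shift k (T x)) {z : ℂ} (hz : ‖z‖ < 1) (y : SeqSpace k) :
    ((embed r)†) (Ring.inverse (1 - z • (shift r)†) ((T†) y)) =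
      ((embed r)†) ((T†) y) +
        z • ((embed r)†) ((T†) (Ring.inverse (1 - z • (shift k)†) (((shift k)†) y))) := by
  have hk := isUnit_one_sub_smul_shift_adjoint k hz
  set v := Ring.inverse (1 - z • (shift k)†) (((shift k)†) y) with hv
  have h1 : v - z • ((shift k)†) v = ((shift k)†) y := by
    simpa using apply_inverse_apply hk (((shift k)†) y)
  -- y + zv is (1 - zS_k^*)⁻¹ y, and T^* carries one resolvent to the other.
  rw [inverse_apply_eq (isUnit_one_sub_smul_shift_adjoint r hz) (y := (T†) (y + z • v))]
  · simp
  · have : ((shift k)†) (y + z • v) = v := by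
      rw [map_add, map_smul, ← h1, sub_add_cancel]
    rw [sub_apply, smul_apply, adjoint_shift_adjoint hT,
      this, one_apply_eq_self, map_add, map_smul, add_sub_cancel_right]

theorem embed_adjoint_resolvent_embed {k : ℕ} {z : ℂ} (hz : ‖z‖ < 1) (x : CVec k) :
    ((embed k)†) (Ring.inverse (1 - z • (shift k)†) (embed k x)) = x := by
  rw [inverse_apply_eq (isUnit_one_sub_smul_shift_adjoint k hz) (y := embed k x),
    embed_adjoint_embed]
  simp [shift_adjoint_embed]

end Sequences

/-! ### U, V and D_V in terms of Ξ. -/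

section Leech

variable {m p q : ℕ} {TG : SeqSpace p →L[ℂ] SeqSpace m} {TK : SeqSpace q →L[ℂ] SeqSpace m}

theorem inverse_defect_embed (hpos : IsStrictlyPositive (TG ∘L TG† - TK ∘L TK†)) (x : CVec q) :
    Ring.inverse (1 - (leechLambda TG TK)† ∘L leechLambda TG TK) (embed q x) =
      embed q x + (TK†) (Xi TG TK x) := by
  rw [leechLambda, (isUnit_defect_and_inverse hpos).2]
  rfl

theorem centralU_apply (hpos : IsStrictlyPositive (TG ∘L TG† - TK ∘L TK†))
    (hG : ∀ x, TG (shift p x) = shift m (TG x)) {z : ℂ} (hz : ‖z‖ < 1) (x : CVec q) :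
    centralU (leechLambda TG TK) z x = DU TG TK x + z • ((embed p)† ∘L TG†)
      (Ring.inverse (1 - z • (shift m)†) (((shift m)† ∘L Xi TG TK) x)) := by
  have h : leechLambda TG TK (Ring.inverse (1 - (leechLambda TG TK)† ∘L leechLambda TG TK)
      (embed q x)) = (TG†) (Xi TG TK x) := by
    have := contraction_apply_inverse_defect hpos (embed q x)
    rw [← (isUnit_defect_and_inverse hpos).2] at this
    exact this
  simp only [centralU, DU, ContinuousLinearMap.comp_apply] at h ⊢
  rw [h, embed_adjoint_resolvent_adjoint hG hz]

theorem centralV_apply (hpos : IsStrictlyPositive (TG ∘L TG† - TK ∘L TK†))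
    (hK : ∀ x, TK (shift q x) = shift m (TK x)) {z : ℂ} (hz : ‖z‖ < 1) (x : CVec q) :
    centralV (leechLambda TG TK) z x = DV TG TK x + z • ((embed q)† ∘L TK†)
      (Ring.inverse (1 - z • (shift m)†) (((shift m)† ∘L Xi TG TK) x)) := by
  have h := inverse_defect_embed hpos x
  simp only [centralV, DV, ContinuousLinearMap.comp_apply, add_apply,
    one_apply_eq_self] at h ⊢
  rw [h, map_add, map_add, embed_adjoint_resolvent_embed hz, embed_adjoint_resolvent_adjoint hK hz,
    add_assoc]

theorem isUnit_centralV (hpos : IsStrictlyPositive (TG ∘L TG† - TK ∘L TK†))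
    (hG : ∀ x, TG (shift p x) = shift m (TG x)) (hK : ∀ x, TK (shift q x) = shift m (TK x))
    {z : ℂ} (hz : ‖z‖ < 1) : IsUnit (centralV (leechLambda TG TK) z) := by
  have hinj : Function.Injective (centralV (leechLambda TG TK) z) := by
    refine (injective_iff_map_eq_zero _).mpr fun x hx => ?_
    have hM := (isUnit_defect_and_inverse hpos).1
    -- h = (1 - Λ^*Λ)⁻¹ E x; by definition V(z)x is E^*(1 - zS^*)⁻¹ h, so `hx` is the vanishing
    -- hypothesis needed.
    have hh := apply_inverse_apply hM (embed q x)
    have h0 := eq_zero_of_defect_eq_embed (norm_contraction_lt_one hpos) shift_adjoint_shift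
      embed_adjoint_shift shift_shift_adjoint_add
      (norm_contraction_shift_le (isUnit_comp_adjoint hpos) hG hK norm_shift_adjoint_apply_le) hz
      (isUnit_one_sub_smul_shift_adjoint q hz) hh hx
    rw [h0, map_zero] at hh
    rw [← embed_adjoint_embed x, ← hh, map_zero]
  exact ContinuousLinearMap.isUnit_iff_bijective.mpr
    ⟨hinj, LinearMap.injective_iff_surjective (f := (centralV (leechLambda TG TK) z).toLinearMap)
      |>.mp hinj⟩

/-- D_V = V(0). -/
theorem isUnit_DV (hpos : IsStrictlyPositive (TG ∘L TG† - TK ∘L TK†))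
    (hG : ∀ x, TG (shift p x) = shift m (TG x)) (hK : ∀ x, TK (shift q x) = shift m (TK x)) :
    IsUnit (DV TG TK) := by
  have hz : ‖(0 : ℂ)‖ < 1 := by simp
  have h := isUnit_centralV hpos hG hK hz
  have e : centralV (leechLambda TG TK) 0 = DV TG TK :=
    ContinuousLinearMap.ext fun x => by rw [centralV_apply hpos hK hz, zero_smul, add_zero]
  rwa [e] at h

end Leech

end LeechRealization

open LeechRealization in
theorem proposition3p1 {m p q : ℕ}
    (G : ℂ → Matrix (Fin m) (Fin p) ℂ) (K : ℂ → Matrix (Fin m) (Fin q) ℂ)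
    (hG : MemHInf G) (hK : MemHInf K)
    (TG : SeqSpace p →L[ℂ] SeqSpace m) (hTG : TG = toeplitz G hG)
    (TK : SeqSpace q →L[ℂ] SeqSpace m) (hTK : TK = toeplitz K hK)
    (hpos : IsStrictlyPositive (TG ∘L TG† - TK ∘L TK†)) :
    -- `Λ` is well defined and a strict contraction, so that `U`, `V` are well defined
    IsUnit (TG ∘L TG†) ∧
    ‖leechLambda TG TK‖ < 1 ∧
    IsUnit (1 - (leechLambda TG TK)† ∘L leechLambda TG TK) ∧
    (∀ z ∈ Metric.ball (0 : ℂ) 1,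
      IsUnit (1 - z • (shift p)†) ∧ IsUnit (1 - z • (shift q)†) ∧
        IsUnit (centralV (leechLambda TG TK) z)) ∧
    -- the realization of `X = U V⁻¹`
    IsUnit (DV TG TK) ∧
    (∀ z ∈ Metric.ball (0 : ℂ) 1,
      IsUnit (1 - z • stateF TG TK) ∧
      centralX (leechLambda TG TK) z =
        DU TG TK ∘L Ring.inverse (DV TG TK) +
          z • (((embed p)† ∘L TG† -
              DU TG TK ∘L Ring.inverse (DV TG TK) ∘L (embed q)† ∘L TK†) ∘L
            Ring.inverse (1 - z • stateF TG TK) ∘L (shift m)† ∘L Xi TG TK ∘L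
            Ring.inverse (DV TG TK))) ∧
    spectralRadius ℂ (stateF TG TK) ≤ 1 := by
  have hGs : ∀ x, TG (shift p x) = shift m (TG x) := hTG ▸ toeplitz_shift hG
  have hKs : ∀ x, TK (shift q x) = shift m (TK x) := hTK ▸ toeplitz_shift hK
  have hDV := isUnit_DV hpos hGs hKs
  have hreal : ∀ z ∈ Metric.ball (0 : ℂ) 1,
      IsUnit (1 - z • stateF TG TK) ∧
      centralX (leechLambda TG TK) z =
        DU TG TK ∘L Ring.inverse (DV TG TK) +
          z • (((embed p)† ∘L TG† -
              DU TG TK ∘L Ring.inverse (DV TG TK) ∘L (embed q)† ∘L TK†) ∘L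
            Ring.inverse (1 - z • stateF TG TK) ∘L (shift m)† ∘L Xi TG TK ∘L
            Ring.inverse (DV TG TK)) := by
    intro z hz
    rw [mem_ball_zero_iff] at hz
    -- The main operator is S_m^*, so S_m^* - c D_V⁻¹ E_q^* T_K^* is F.
    exact quotient_realization (c := (shift m)† ∘L Xi TG TK)
      (isUnit_one_sub_smul_shift_adjoint m hz) hDV (isUnit_centralV hpos hGs hKs hz)
      (centralV_apply hpos hKs hz) (centralU_apply hpos hGs hz)
  refine ⟨isUnit_comp_adjoint hpos, norm_contraction_lt_one hpos,
    (isUnit_defect_and_inverse hpos).1, fun z hz => ?_, hDV, hreal,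
    spectralRadius_le_one_of_isUnit fun z hz => (hreal z hz).1⟩
  rw [mem_ball_zero_iff] at hz
  exact ⟨isUnit_one_sub_smul_shift_adjoint p hz, isUnit_one_sub_smul_shift_adjoint q hz,
    isUnit_centralV hpos hGs hKs hz⟩
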